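/- Let $(b_1,b_2)$ be a basis of $\mathbb{R}^2$, that is, a basis of the lattice $\mathbb{Z}b_1+\mathbb{Z}b_2$. The Gaussian algorithm repeats the following on $(b_1,b_2)$. Put $m=(b_2,b_1)/(b_1,b_1)$, let $x$ be the integer nearest to $m$ (so that $-1/2\le m-x<1/2$), and replace $b_2$ by $b_2-xb_1$. If now $|b_1|>|b_2|$, swap $b_1$ and $b_2$ and start again; if $|b_1|\le|b_2|$, stop. A step is an integer translation followed by a swap. The length of a basis is $L(b_1,b_2)=\max(|b_1|,|b_2|)$, where $|\cdot|$ is the Euclidean norm. For $k\in\mathbb{N}$ let $g(k)$ be the minimum length of those bases with integer coordinates ($b_1,b_2\in\mathbb{Z}^2$) on which the algorithm performs at least $k$ steps. Theorem. There is an absolute constant $A>0$ such that for every integer $k>2$: (i) every input basis $(b_1,b_2)$ with integer coordinates on which the Gaussian algorithm performs more than $k$ steps has length at least $A(1+\sqrt2)^k$; (ii) more generally, every input basis $(b_1,b_2)$ of $\mathbb{R}^2$ on which the Gaussian algorithm performs more than $k$ steps has length at least $A(1+\sqrt2)^k\,\lambda_1$, where $\lambda_1$ is the Euclidean norm of a shortest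 nonzero vector of the lattice $\mathbb{Z}b_1+\mathbb{Z}b_2$; (iii) $g(k)\ge A(1+\sqrt2)^k$. -/

import Mathlib

namespace GaussLattice

/-- The Euclidean plane. -/
abbrev Plane := EuclideanSpace ℝ (Fin 2)

/-- An ordered pair `(b₁, b₂)` of vectors of the plane, the data on which the algorithm works. -/
abbrev Pair := Plane × Plane

/-- The pair is a basis of a two-dimensional lattice: its vectors are linearly independent. -/
def IsBasis (B : Pair) : Prop := LinearIndependent ℝ ![B.1, B.2]

/-- All coordinates of both vectors are integers. -/
def IsIntegral (B : Pair) : Prop :=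
  ∀ i : Fin 2, (∃ n : ℤ, B.1 i = (n : ℝ)) ∧ (∃ n : ℤ, B.2 i = (n : ℝ))

/-- The lattice generated by the pair: all integer linear combinations of its vectors. -/
def lattice (B : Pair) : Submodule ℤ Plane := Submodule.span ℤ {B.1, B.2}

/-- The length of the shortest nonzero vectors of the lattice generated by the pair. -/
noncomputable def firstMinimum (B : Pair) : ℝ :=
  sInf {r : ℝ | ∃ v ∈ lattice B, v ≠ 0 ∧ r = ‖v‖}

/-- The length of a basis: the maximum of the Euclidean norms of its two vectors. -/
noncomputable def length (B : Pair) : ℝ := max ‖B.1‖ ‖B.2‖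

/-- The Gram-Schmidt coefficient `m = (b₂, b₁) / (b₁, b₁)`. -/
noncomputable def coeff (B : Pair) : ℝ := inner ℝ B.2 B.1 / inner ℝ B.1 B.1

/-- The integer translation: `b₂` is replaced by `b₂ - x b₁`, where `x` is the integer nearest to
`m` (the one with `-1/2 ≤ m - x < 1/2`, so that the result is a proper basis). -/
noncomputable def translate (B : Pair) : Pair := (B.1, B.2 - ⌊coeff B + 1 / 2⌋ • B.1)

/-- One step of the Gaussian algorithm: an integer translation followed by the swap of the
two vectors. -/
noncomputable def step (B : Pair) : Pair := (translate B).swap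

/-- After the integer translation `|b₁| > |b₂|`, so the algorithm swaps and goes on; otherwise
it stops after the translation. -/
def Continues (B : Pair) : Prop := ‖(translate B).2‖ < ‖(translate B).1‖

/-- The Gaussian algorithm with input `B` performs at least `k` steps. -/
def DemandsAtLeast : ℕ → Pair → Prop
  | 0, _ => True
  | k + 1, B => Continues B ∧ DemandsAtLeast k (step B)

/-- The Gaussian algorithm with input `B` performs more than `k` steps. -/
def DemandsMoreThan (k : ℕ) (B : Pair) : Prop := DemandsAtLeast (k + 1) B

/-- `g k` is the minimum length of the integral input bases that demand at least `k` steps. -/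
noncomputable def g (k : ℕ) : ℝ :=
  sInf {r : ℝ | ∃ B : Pair, IsBasis B ∧ IsIntegral B ∧ DemandsAtLeast k B ∧ r = length B}

end GaussLattice

namespace GaussLattice

/-! The successive vectors of a run satisfy v_i = x_i v_{i+1} + v_{i+2}, and so do their inner
products with any fixed w. After the first step every quotient has |x_i| ≥ 2 (`two_le_abs_quot`),
and if |x_i| = 2 the next quotient of the run has the same sign (`quot_mul_quot_step_pos`). Hence
for |x_i| = 2 nothing cancels and the absolute values obey q = 2p + r, whose dominant root is 1 +
√2; for |x_i| ≥ 3 a factor 5/2 > 1 + √2 survives any cancellation (`recurrence_growth`). With w a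
lattice vector near the end of the run, Cauchy–Schwarz turns this growth into a bound on |b₁|/|w|,
and |w| ≥ λ₁, where λ₁ ≥ 1 for integral bases. -/

/-- The integer quotient used in the translation. -/
noncomputable def quot (B : Pair) : ℤ := ⌊coeff B + 1 / 2⌋

/-- The size condition satisfied by every pair that results from a step. -/
def Reduced (B : Pair) : Prop := ‖B.1‖ < ‖B.2‖ ∧ 2 * |inner ℝ B.1 B.2| ≤ inner ℝ B.2 B.2

/-! ### Quotients of consecutive steps -/

lemma step_fst (B : Pair) : (step B).1 = B.2 - (quot B : ℝ) • B.1 := by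
  simp [step, translate, quot, Int.cast_smul_eq_zsmul]

lemma step_snd (B : Pair) : (step B).2 = B.1 := rfl

lemma inner_self_lt_of_norm_lt {u v : Plane} (h : ‖u‖ < ‖v‖) :
    inner ℝ u u < inner ℝ v v := by
  rw [real_inner_self_eq_norm_sq, real_inner_self_eq_norm_sq]
  gcongr

lemma Continues.norm_lt {B : Pair} (h : Continues B) : ‖(step B).1‖ < ‖B.1‖ := h

lemma Continues.inner_pos {B : Pair} (h : Continues B) : 0 < inner ℝ B.1 B.1 :=
  lt_of_le_of_lt real_inner_self_nonneg (inner_self_lt_of_norm_lt h.norm_lt)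

lemma inner_snd_left (B : Pair) (w : Plane) :
    inner ℝ B.2 w = quot B * inner ℝ B.1 w + inner ℝ (step B).1 w := by
  rw [step_fst, inner_sub_left, real_inner_smul_left]; ring

lemma Continues.reduced_step {B : Pair} (h : Continues B) : Reduced (step B) := by
  refine ⟨h.norm_lt, ?_⟩
  have hp := h.inner_pos
  rw [step_snd]
  have e := inner_snd_left B B.1
  have hc : coeff B * inner ℝ B.1 B.1 = inner ℝ B.2 B.1 := div_mul_cancel₀ _ hp.ne'
  have h1 : (quot B : ℝ) ≤ coeff B + 1 / 2 := Int.floor_le _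
  have h2 : coeff B + 1 / 2 < quot B + 1 := Int.lt_floor_add_one _
  have h3 : inner ℝ (step B).1 B.1 = (coeff B - quot B) * inner ℝ B.1 B.1 := by linarith
  rw [h3, abs_mul, abs_of_pos hp]
  have : |coeff B - quot B| ≤ 1 / 2 := abs_le.2 ⟨by linarith, by linarith⟩
  nlinarith

/-- For x ∈ {-1, 0, 1} the size condition gives |b₂ - x b₁| ≥ |b₁|, so the algorithm would stop. -/
lemma two_le_abs_quot {B : Pair} (hB : Reduced B) (h : Continues B) : 2 ≤ |quot B| := by
  have h1 := inner_self_lt_of_norm_lt hB.1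
  have h2 := inner_self_lt_of_norm_lt h.norm_lt
  have h3 := hB.2
  have h4 := le_abs_self (inner ℝ B.1 B.2)
  have h5 := neg_abs_le (inner ℝ B.1 B.2)
  have e : inner ℝ (step B).1 (step B).1 = inner ℝ B.2 B.2 - 2 * quot B * inner ℝ B.1 B.2
      + (quot B : ℝ) ^ 2 * inner ℝ B.1 B.1 := by
    rw [step_fst]
    simp only [inner_sub_left, inner_sub_right, real_inner_smul_left, real_inner_smul_right,
      real_inner_comm B.1 B.2]
    ring
  by_contra! hx
  obtain ⟨ha, hb⟩ := abs_lt.1 hx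
  have : quot B = -1 ∨ quot B = 0 ∨ quot B = 1 := by omega
  rcases this with hq | hq | hq <;> rw [hq] at e <;> push_cast at e <;> linarith

/-- Let b₂ = 2b₁ + r. The size condition 2(b₁,b₂) ≤ (b₂,b₂) says (r,b₂) ≥ 0, that is, (b₁,r) ≥
-(r,r)/2. The next quotient is within 1/2 of (b₁,r)/(r,r), so it exceeds -2. The case -2 is
symmetric. -/
lemma quot_mul_quot_step_pos {B : Pair} (hB : Reduced B) (h : Continues B)
    (h' : Continues (step B)) (hx : |quot B| = 2) : 0 < quot B * quot (step B) := by
  have hy := two_le_abs_quot h.reduced_step h'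
  have hr := h'.inner_pos
  have h1 := h'.reduced_step.2
  have h3 := hB.2
  have h4 := abs_le.1 (show |inner ℝ B.1 B.2| ≤ inner ℝ B.2 B.2 / 2 by linarith)
  rw [step_snd] at h1
  have h5 := abs_le.1 (show |inner ℝ (step (step B)).1 (step B).1| ≤
    inner ℝ (step B).1 (step B).1 / 2 by linarith)
  have e1 := inner_snd_left (step B) (step B).1
  rw [step_snd] at e1
  have e2 := inner_snd_left B B.1
  have e3 := inner_snd_left B B.2
  have e4 := inner_snd_left B (step B).1
  rw [real_inner_comm B.2 (step B).1] at e3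
  rw [real_inner_comm B.1 B.2] at e2
  rw [real_inner_comm B.1 (step B).1] at e2
  generalize inner ℝ (step B).1 (step B).1 = R at *
  generalize inner ℝ B.1 (step B).1 = T at *
  rcases eq_or_eq_neg_of_abs_eq hx with hq | hq <;> rw [hq] at e2 e3 e4 ⊢ <;>
    push_cast at e2 e3 e4
  · have : (-2 : ℝ) < quot (step B) := by
      by_contra! hc
      nlinarith
    have : (-2 : ℤ) < quot (step B) := by exact_mod_cast this
    rcases le_abs'.1 hy <;> omega
  · have : (quot (step B) : ℝ) < 2 := by
      by_contra! hc
      nlinarith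
    have : quot (step B) < 2 := by exact_mod_cast this
    rcases le_abs'.1 hy <;> omega

/-! ### Growth of inner products -/

/-- Growth of a linear recurrence `q = x p + r` with quotient `|x| ≥ 2`. -/
lemma recurrence_growth {x : ℤ} {p q r : ℝ} (hx : 2 ≤ |x|) (e : q = x * p + r)
    (hs : |x| = 2 → 0 ≤ x * (r * p)) (hr : 3 * |r| ≤ 2 * |p|) :
    2 * |p| ≤ |q| ∧ 0 ≤ x * (p * q) ∧
      (2 * |p| + |r| ≤ |q| ∨ (2 * |r| ≤ |p| → 5 / 2 * |p| ≤ |q|)) := by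
  have hxp : |(x : ℝ) * p| = |(x : ℝ)| * |p| := abs_mul _ _
  have hp := abs_nonneg p
  have hrp : |(x : ℝ) * (r * p)| = |(x : ℝ)| * (|r| * |p|) := by rw [abs_mul, abs_mul]
  have hq : |(x : ℝ) * p| - |r| ≤ |q| := by
    rw [e]; simpa using abs_sub_abs_le_abs_sub ((x : ℝ) * p) (-r)
  have hx' : (2 : ℝ) ≤ |(x : ℝ)| := by exact_mod_cast hx
  have hsq : (x : ℝ) * (p * q) = |(x : ℝ)| ^ 2 * |p| ^ 2 + x * (r * p) := by
    rw [e, sq_abs, sq_abs]; ring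
  have hsign : 0 ≤ x * (p * q) := by
    have h1 := neg_abs_le ((x : ℝ) * (r * p))
    have h2 : |(x : ℝ)| * (|r| * |p|) ≤ |(x : ℝ)| * (|p| * |p|) :=
      mul_le_mul_of_nonneg_left (mul_le_mul_of_nonneg_right (by linarith) hp) (abs_nonneg _)
    have h3 : |(x : ℝ)| * |p| ^ 2 ≤ |(x : ℝ)| ^ 2 * |p| ^ 2 := by
      gcongr; nlinarith
    rw [hsq]; nlinarith
  rcases hx.eq_or_lt with h2 | h3
  · have hx2 : |(x : ℝ)| = 2 := by exact_mod_cast h2.symm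
    have h0 := hs h2.symm
    have h4 : 2 * |p| + |r| ≤ |q| := by
      have : |(x : ℝ) * p + r| = |(x : ℝ) * p| + |r| := by
        apply abs_add_eq_add_abs_iff _ _ |>.2
        by_contra! hc
        have h5 : x * p * r < 0 := by
          rcases lt_or_ge (x * p : ℝ) 0 with h | h
          · exact mul_neg_of_neg_of_pos h (hc.2 h.le)
          · exact mul_neg_of_pos_of_neg
              (lt_of_le_of_ne h (by
                intro h'
                have := hc.1 h
                have := hc.2 h'.ge
                linarith)) (hc.1 h)
        linarith [show (x : ℝ) * p * r = x * (r * p) by ring]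
      rw [e, this, hxp, hx2]
    exact ⟨by linarith [abs_nonneg r], hsign, Or.inl h4⟩
  · have h3' : (3 : ℝ) ≤ |(x : ℝ)| := by exact_mod_cast h3
    have h5 : 3 * |p| ≤ |(x : ℝ)| * |p| := by gcongr
    exact ⟨by linarith, hsign, Or.inr fun h => by linarith⟩

lemma Reduced.inner_growth_one {B : Pair} (hB : Reduced B) (h : Continues B) :
    3 * |inner ℝ B.1 B.1| ≤ 2 * |inner ℝ B.2 B.1| ∧
      0 ≤ quot B * (inner ℝ B.1 B.1 * inner ℝ B.2 B.1) := by
  have hx : (2 : ℝ) ≤ |(quot B : ℝ)| := by exact_mod_cast two_le_abs_quot hB h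
  have hp := h.inner_pos
  have hr := h.reduced_step.2
  rw [step_snd] at hr
  have e := inner_snd_left B B.1
  generalize inner ℝ B.1 B.1 = P at *
  have h1 := abs_le.1 (show |inner ℝ (step B).1 B.1| ≤ P / 2 by linarith)
  rw [e, abs_of_pos hp]
  generalize inner ℝ (step B).1 B.1 = R at *
  rcases le_abs'.1 hx with h2 | h2
  · have h3 : (quot B : ℝ) * P + R ≤ -(3 / 2 * P) := by nlinarith
    have h4 := neg_abs_le ((quot B : ℝ) * P + R)
    refine ⟨by linarith, mul_nonneg_of_nonpos_of_nonpos (by linarith) ?_⟩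
    exact mul_nonpos_of_nonneg_of_nonpos hp.le (by linarith)
  · have h3 : 3 / 2 * P ≤ (quot B : ℝ) * P + R := by nlinarith
    have h4 := le_abs_self ((quot B : ℝ) * P + R)
    exact ⟨by linarith, mul_nonneg (by linarith) (mul_nonneg hp.le (by linarith))⟩

lemma lattice_step_le (B : Pair) : lattice (step B) ≤ lattice B := by
  have h1 : B.1 ∈ lattice B := Submodule.subset_span (by simp)
  have h2 : B.2 ∈ lattice B := Submodule.subset_span (by simp)
  refine Submodule.span_le.2 ?_
  rintro v (rfl | rfl)
  · exact Submodule.sub_mem _ h2 (Submodule.smul_mem _ _ h1)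
  · exact h1

lemma sq_one_add_sqrt_two : (1 + √2) ^ 2 = 2 * (1 + √2) + 1 := by
  have := Real.sq_sqrt (show (0 : ℝ) ≤ 2 by norm_num)
  linarith [show (1 + √2) ^ 2 = 1 + 2 * √2 + √2 ^ 2 by ring]

lemma sqrt_two_le : √2 ≤ 3 / 2 := by
  rw [Real.sqrt_le_left (by norm_num)]; norm_num

lemma step_inner_growth {B : Pair} (hB : Reduced B) (h : Continues B) (h' : Continues (step B))
    {w : Plane} (hr : 3 * |inner ℝ (step B).1 w| ≤ 2 * |inner ℝ B.1 w|)
    (hs : 0 ≤ quot (step B) * (inner ℝ (step B).1 w * inner ℝ B.1 w)) :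
    2 * |inner ℝ B.1 w| ≤ |inner ℝ B.2 w| ∧
      0 ≤ quot B * (inner ℝ B.1 w * inner ℝ B.2 w) ∧
      (2 * |inner ℝ B.1 w| + |inner ℝ (step B).1 w| ≤ |inner ℝ B.2 w| ∨
        (2 * |inner ℝ (step B).1 w| ≤ |inner ℝ B.1 w| →
          5 / 2 * |inner ℝ B.1 w| ≤ |inner ℝ B.2 w|)) := by
  refine recurrence_growth (two_le_abs_quot hB h) (inner_snd_left B w) (fun hx => ?_) hr
  have h1 : (0 : ℝ) < quot B * quot (step B) := by
    exact_mod_cast quot_mul_quot_step_pos hB h h' hx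
  generalize inner ℝ (step B).1 w * inner ℝ B.1 w = t at *
  by_contra! hc
  have h2 : (quot B : ℝ) * t * (quot B * quot (step B)) < 0 := mul_neg_of_neg_of_pos hc h1
  nlinarith [mul_nonneg (sq_nonneg (quot B : ℝ)) hs]

/-- Inner products with a fixed lattice vector grow along the algorithm, read backwards. -/
lemma Reduced.exists_inner_growth (n : ℕ) : ∀ {B : Pair}, Reduced B → DemandsAtLeast (n + 2) B →
    ∃ w ∈ lattice B, w ≠ 0 ∧
      2 * |inner ℝ B.1 w| ≤ |inner ℝ B.2 w| ∧
      0 ≤ quot B * (inner ℝ B.1 w * inner ℝ B.2 w) ∧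
      (1 + √2) ^ n * inner ℝ w w ≤ |inner ℝ B.1 w| ∧
      (1 + √2) ^ (n + 1) * inner ℝ w w ≤ |inner ℝ B.2 w| := by
  induction n with
  | zero =>
    intro B hB ⟨h, h', _⟩
    obtain ⟨h1, h2⟩ := h.reduced_step.inner_growth_one h'
    obtain ⟨h3, h4, -⟩ := step_inner_growth hB h h' h1 h2
    have hp := h'.inner_pos
    -- The first ratio is only known to be at least 2 - 1/2 = 3/2, which is why `recurrence_growth`
    -- assumes no more than that.
    refine ⟨(step B).1, lattice_step_le B (Submodule.subset_span (by simp)), ?_, h3, h4, ?_⟩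
    · intro h0
      simp [h0] at hp
    · have := sqrt_two_le
      rw [abs_of_pos hp, step_snd] at h1
      constructor
      · linarith
      · rw [zero_add, pow_one]
        nlinarith
  | succ n ih =>
    intro B hB ⟨h, h'⟩
    obtain ⟨w, hw, hw0, h1, h2, h3, h4⟩ := ih h.reduced_step h'
    rw [step_snd] at h1 h2 h4
    have h0 := abs_nonneg (inner ℝ (step B).1 w)
    obtain ⟨h5, h6, h7⟩ := step_inner_growth hB h h'.1 (by linarith) h2
    refine ⟨w, lattice_step_le B hw, hw0, h5, h6, h4, ?_⟩
    -- Quotient ±2 reproduces φ² = 2φ + 1 for φ = 1 + √2; a larger one gives 5/2 ≥ φ outright.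
    rcases h7 with h7 | h7
    · have e : (1 + √2) ^ (n + 1 + 1) = 2 * (1 + √2) ^ (n + 1) + (1 + √2) ^ n := by
        linear_combination (1 + √2) ^ n * sq_one_add_sqrt_two
      rw [e]
      linarith
    · have h8 : (1 + √2) * ((1 + √2) ^ (n + 1) * inner ℝ w w) ≤ 5 / 2 * |inner ℝ B.1 w| :=
        mul_le_mul (by linarith [sqrt_two_le]) h4
          (mul_nonneg (by positivity) real_inner_self_nonneg) (by norm_num)
      linarith [h7 h1, show (1 + √2) ^ (n + 1 + 1) * inner ℝ w w =
        (1 + √2) * ((1 + √2) ^ (n + 1) * inner ℝ w w) by ring]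

/-! ### Bounds on the length -/

lemma firstMinimum_le {B : Pair} {w : Plane} (hw : w ∈ lattice B) (h0 : w ≠ 0) :
    firstMinimum B ≤ ‖w‖ := by
  refine csInf_le ⟨0, ?_⟩ ⟨w, hw, h0, rfl⟩
  rintro r ⟨v, -, -, rfl⟩
  exact norm_nonneg v

theorem pow_mul_firstMinimum_le_length {n : ℕ} {B : Pair} (h : DemandsAtLeast (n + 3) B) :
    (1 + √2) ^ (n + 1) * firstMinimum B ≤ length B := by
  obtain ⟨w, hw, hw0, -, -, -, h4⟩ := h.1.reduced_step.exists_inner_growth n h.2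
  rw [step_snd, real_inner_self_eq_norm_sq] at h4
  have h5 := h4.trans (abs_real_inner_le_norm _ _)
  have hpos : 0 < ‖w‖ := norm_pos_iff.2 hw0
  have h6 : (1 + √2) ^ (n + 1) * ‖w‖ ≤ ‖B.1‖ := by
    refine le_of_mul_le_mul_right ?_ hpos
    linarith [show (1 + √2) ^ (n + 1) * ‖w‖ * ‖w‖ = (1 + √2) ^ (n + 1) * ‖w‖ ^ 2 by ring]
  calc (1 + √2) ^ (n + 1) * firstMinimum B ≤ (1 + √2) ^ (n + 1) * ‖w‖ := by
        gcongr
        exact firstMinimum_le (lattice_step_le B hw) hw0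
    _ ≤ ‖B.1‖ := h6
    _ ≤ length B := le_max_left _ _

lemma IsIntegral.exists_int_of_mem_lattice {B : Pair} (hB : IsIntegral B) {v : Plane}
    (hv : v ∈ lattice B) (i : Fin 2) : ∃ n : ℤ, v i = n := by
  obtain ⟨a, b, rfl⟩ := Submodule.mem_span_pair.1 hv
  obtain ⟨⟨m, hm⟩, ⟨n, hn⟩⟩ := hB i
  exact ⟨a * m + b * n, by simp [hm, hn]⟩

lemma one_le_norm_of_int {v : Plane} (hv : ∀ i, ∃ n : ℤ, v i = n) (h0 : v ≠ 0) : 1 ≤ ‖v‖ := by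
  obtain ⟨i, hi⟩ : ∃ i, v i ≠ 0 := by
    by_contra! hc
    exact h0 (by ext i; simpa using hc i)
  obtain ⟨n, hn⟩ := hv i
  have hn0 : n ≠ 0 := by
    rintro rfl
    simp [hn] at hi
  calc (1 : ℝ) ≤ |(n : ℝ)| := by exact_mod_cast Int.one_le_abs hn0
    _ = ‖v i‖ := by rw [hn, Real.norm_eq_abs]
    _ ≤ ‖v‖ := PiLp.norm_apply_le v i

lemma IsIntegral.one_le_firstMinimum {B : Pair} (hB : IsIntegral B) (hb : IsBasis B) :
    1 ≤ firstMinimum B := by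
  refine le_csInf ⟨_, B.1, Submodule.subset_span (by simp), hb.ne_zero 0, rfl⟩ ?_
  rintro r ⟨v, hv, h0, rfl⟩
  exact one_le_norm_of_int (hB.exists_int_of_mem_lattice hv) h0

theorem IsIntegral.pow_le_length {n : ℕ} {B : Pair} (hB : IsIntegral B) (hb : IsBasis B)
    (h : DemandsAtLeast (n + 3) B) : (1 + √2) ^ (n + 1) ≤ length B :=
  (le_mul_of_one_le_right (by positivity) (hB.one_le_firstMinimum hb)).trans
    (pow_mul_firstMinimum_le_length h)

/-! ### Long runs exist, so the infimum in `g` is not the default value 0 of an empty set -/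

lemma coeff_add_two_smul {p q : Plane} (hq : q ≠ 0) :
    coeff (q, p + (2 : ℝ) • q) = inner ℝ p q / inner ℝ q q + 2 := by
  have : inner ℝ q q ≠ (0 : ℝ) := inner_self_ne_zero.2 hq
  simp only [coeff, inner_add_left, real_inner_smul_left]
  field_simp

lemma step_add_two_smul {p q : Plane} (h0 : 0 ≤ inner ℝ p q)
    (h1 : 2 * inner ℝ p q < inner ℝ q q) : step (q, p + (2 : ℝ) • q) = (p, q) := by
  have hq : 0 < inner ℝ q q := by linarith
  have hc : quot (q, p + (2 : ℝ) • q) = 2 := by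
    rw [quot, coeff_add_two_smul (by rintro rfl; simp at hq), Int.floor_eq_iff]
    have h2 : inner ℝ p q / inner ℝ q q < 1 / 2 := by rw [div_lt_iff₀ hq]; linarith
    have h3 : 0 ≤ inner ℝ p q / inner ℝ q q := by positivity
    push_cast
    constructor <;> linarith
  refine Prod.ext ?_ rfl
  rw [step_fst, hc]
  simp

/-- Bases of arbitrarily long runs, with the properties that allow one more step in front. -/
lemma exists_demandsAtLeast (k : ℕ) : ∃ p q : Plane, IsBasis (p, q) ∧ IsIntegral (p, q) ∧
    DemandsAtLeast k (p, q) ∧ 0 ≤ inner ℝ p q ∧ 2 * inner ℝ p q < inner ℝ q q ∧ ‖p‖ < ‖q‖ := by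
  induction k with
  | zero =>
    refine ⟨!₂[1, 0], !₂[0, 2], ?_, ?_, trivial, ?_, ?_, ?_⟩
    · rw [IsBasis, LinearIndependent.pair_iff]
      intro s t h
      have h0 := congrArg (fun v : Plane => v 0) h
      have h1 := congrArg (fun v : Plane => v 1) h
      simpa using And.intro h0 h1
    · intro i
      fin_cases i
      · exact ⟨⟨1, by simp⟩, ⟨0, by simp⟩⟩
      · exact ⟨⟨0, by simp⟩, ⟨2, by simp⟩⟩
    · simp [PiLp.inner_apply, Fin.sum_univ_two]
    · simp [PiLp.inner_apply, Fin.sum_univ_two]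
    · simp [EuclideanSpace.norm_eq, Fin.sum_univ_two]
  | succ k ih =>
    obtain ⟨p, q, hb, hi, hd, h0, h1, h2⟩ := ih
    have hs := step_add_two_smul h0 h1
    have hp : 0 < inner ℝ p p := real_inner_self_pos.2 (hb.ne_zero 0)
    have e : inner ℝ (p + (2 : ℝ) • q) (p + (2 : ℝ) • q) =
        inner ℝ p p + 4 * inner ℝ p q + 4 * inner ℝ q q := by
      simp only [inner_add_left, inner_add_right, real_inner_smul_left, real_inner_smul_right,
        real_inner_comm p q]
      ring
    have e' : inner ℝ q (p + (2 : ℝ) • q) = inner ℝ p q + 2 * inner ℝ q q := by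
      simp only [inner_add_right, real_inner_smul_right, real_inner_comm p q]
    refine ⟨q, p + (2 : ℝ) • q, ?_, ?_, ⟨?_, by rwa [hs]⟩, ?_, ?_, ?_⟩
    · rw [IsBasis, LinearIndependent.pair_iff] at hb ⊢
      intro s t h
      have := hb t (s + 2 * t) (by rw [← h]; module)
      constructor <;> linarith
    · intro i
      obtain ⟨⟨m, hm⟩, ⟨n, hn⟩⟩ := hi i
      exact ⟨⟨n, hn⟩, ⟨m + 2 * n, by simp at hm hn; simp [hm, hn]⟩⟩
    · have : ‖(step (q, p + (2 : ℝ) • q)).1‖ < ‖q‖ := by rwa [hs]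
      exact this
    · rw [e']; linarith
    · rw [e, e']; linarith
    · refine lt_of_pow_lt_pow_left₀ 2 (norm_nonneg _) ?_
      rw [← real_inner_self_eq_norm_sq, ← real_inner_self_eq_norm_sq, e]
      linarith

theorem pow_le_g (n : ℕ) : (1 + √2) ^ (n + 1) ≤ g (n + 3) := by
  obtain ⟨p, q, hb, hi, hd, -⟩ := exists_demandsAtLeast (n + 3)
  refine le_csInf ⟨_, (p, q), hb, hi, hd, rfl⟩ ?_
  rintro r ⟨B, hb, hi, hd, rfl⟩
  exact hi.pow_le_length hb hd

end GaussLattice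

theorem mainTheorem1 :
    ∃ A : ℝ, 0 < A ∧ ∀ k : ℕ, 2 < k →
      (∀ B : GaussLattice.Pair, GaussLattice.IsBasis B → GaussLattice.IsIntegral B →
        GaussLattice.DemandsMoreThan k B →
        A * (1 + √2) ^ k ≤ GaussLattice.length B) ∧
      (∀ B : GaussLattice.Pair, GaussLattice.IsBasis B →
        GaussLattice.DemandsMoreThan k B →
        A * (1 + √2) ^ k * GaussLattice.firstMinimum B ≤ GaussLattice.length B) ∧
      A * (1 + √2) ^ k ≤ GaussLattice.g k := by
  have hφ : (0 : ℝ) < 1 + √2 := by positivity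
  have h1 : (1 : ℝ) ≤ 1 + √2 := by linarith [Real.sqrt_nonneg 2]
  -- The bound for `g k`, with at least k steps, has exponent k - 2 and fixes the constant; more
  -- than k steps leave one factor to spare.
  refine ⟨((1 + √2) ^ 2)⁻¹, by positivity, fun k hk => ?_⟩
  obtain ⟨n, rfl⟩ : ∃ n, k = n + 3 := ⟨k - 3, by omega⟩
  have e : ((1 + √2) ^ 2)⁻¹ * (1 + √2) ^ (n + 3) = (1 + √2) ^ (n + 1) := by
    field_simp
    ring
  have hle : (1 + √2) ^ (n + 1) ≤ (1 + √2) ^ (n + 1 + 1) :=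
    pow_le_pow_right₀ h1 (by omega)
  rw [e]
  refine ⟨fun B hb hi hd => ?_, fun B hb hd => ?_, GaussLattice.pow_le_g n⟩
  · exact hle.trans (hi.pow_le_length (n := n + 1) hb hd)
  · refine le_trans ?_ (GaussLattice.pow_mul_firstMinimum_le_length (n := n + 1) hd)
    gcongr
    refine Real.sInf_nonneg ?_
    rintro r ⟨v, -, -, rfl⟩
    exact norm_nonneg v
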